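/- **Equivalent Decomposition.** All graphs below have the same finite vertex set $\mathbf V$. Two DAGs are *Markov equivalent* if they induce the same d-separation relations. The *CPDAG* of a DAG $\mathcal G$ is the partially directed acyclic graph (PDAG) with the skeleton of $\mathcal G$ in which an edge is directed if and only if it appears, with this direction, in every DAG Markov equivalent to $\mathcal G$; for a CPDAG $\mathcal G^*$, $[\mathcal G^*]$ denotes the Markov equivalence class it represents. A *pairwise causal constraint* is one of the propositions "$X$ is a parent of $Y$", "$X$ is an ancestor of $Y$", "$X$ is not an ancestor of $Y$", with $X,Y\in\mathbf V$ (every vertex is an ancestor of itself). For a set $\mathcal B$ of such constraints, $[\mathcal G^*,\mathcal B]$ is the set of DAGs in $[\mathcal G^*]$ satisfying all of $\mathcal B$, and $\mathcal B$ is *consistent* with $\mathcal G^*$ if $[\mathcal G^*,\mathcal B]\ne\varnothing$. In that case the *MPDAG of* $[\mathcal G^*,\mathcal B]$ is the PDAG $\mathcal H$ with the same skeleton and v-structures as $\mathcal G^*$ in which an edge is directed if and only if it appears, with this direction, in all DAGs in $[\mathcal G^*,\mathcal B]$; $[\mathcal H]$ is the set of DAGs that contain all directed edges of $\mathcal H$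 and have the same skeleton and v-structures as $\mathcal H$. A *direct causal clause* (DCC) $\kappa$ consists of a tail $\kappa_t\in\mathbf V$ and a head set $\kappa_h\subseteq\mathbf V\setminus\{\kappa_t\}$; it holds for a DAG $\mathcal G$ if some vertex of $\kappa_h$ is a child of $\kappa_t$ in $\mathcal G$. For a set $\mathcal R$ of DCCs, $[\mathcal H,\mathcal R]$ is the set of DAGs in $[\mathcal H]$ satisfying all clauses in $\mathcal R$. Let $\mathcal G^*$ be a CPDAG and let $\mathcal B$ be a set of pairwise causal constraints consistent with $\mathcal G^*$. Then the MPDAG $\mathcal H$ of $[\mathcal G^*,\mathcal B]$ exists and is unique, and there is a set $\mathcal R$ of DCCs such that $$[\mathcal G^*,\mathcal B]=[\mathcal H,\mathcal R],$$ and $\mathcal R$ is minimal in the sense that $[\mathcal G^*,\mathcal B]\subsetneq[\mathcal H,\mathcal R']$ for every proper subset $\mathcal R'\subsetneq\mathcal R$. -/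

import Mathlib

/-- A partially directed acyclic graph on the vertex set `V`: between two distinct vertices there is
at most one edge, directed or undirected, there are no loops and there is no directed cycle. -/
@[ext]
structure PDAG (V : Type*) where
  /-- `dir x y` is the directed edge `x → y`. -/
  dir : V → V → Prop
  /-- `undir x y` is the undirected edge `x - y`. -/
  undir : V → V → Prop
  undir_symm : ∀ x y, undir x y → undir y x
  undir_irrefl : ∀ x, ¬ undir x x
  dir_not_undir : ∀ x y, dir x y → ¬ undir x y
  acyclic : ∀ x, ¬ Relation.TransGen dir x x

namespace PDAG

variable {V : Type*}

/-- A directed acyclic graph: every edge is directed. -/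
def IsDAG (G : PDAG V) : Prop := ∀ x y, ¬ G.undir x y

/-- Two vertices are adjacent if they are joined by an edge of any kind. -/
def Adj (G : PDAG V) (x y : V) : Prop := G.dir x y ∨ G.dir y x ∨ G.undir x y

/-- The set of children of a vertex. -/
def children (G : PDAG V) (x : V) : Set V := {y | G.dir x y}

/-- `x` is an ancestor of `y`: either `x = y` or there is a directed path from `x` to `y`. -/
def IsAncestor (G : PDAG V) (x y : V) : Prop := Relation.ReflTransGen G.dir x y

def SameSkeleton (G H : PDAG V) : Prop := ∀ x y, G.Adj x y ↔ H.Adj x y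

/-- The triple `(x, y, z)` is a v-structure collided on `y`. -/
def IsVStructure (G : PDAG V) (x y z : V) : Prop :=
  x ≠ z ∧ G.dir x y ∧ G.dir z y ∧ ¬ G.Adj x z

def SameVStructures (G H : PDAG V) : Prop :=
  ∀ x y z, G.IsVStructure x y z ↔ H.IsVStructure x y z

/-- `p` is a path from `x` to `y`: a sequence of distinct vertices, consecutive ones adjacent. -/
def IsPath (G : PDAG V) (x y : V) (p : List V) : Prop :=
  p.Nodup ∧ p.IsChain G.Adj ∧ p.head? = some x ∧ p.getLast? = some y

/-- The path `p` of a DAG is blocked by `Z`: it has a non-collider in `Z`, or a collider without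
descendants in `Z` (a vertex is a descendant of itself). -/
def IsBlocked (G : PDAG V) (Z : Set V) (p : List V) : Prop :=
  ∃ a b c, [a, b, c] <:+: p ∧
    (((G.dir b a ∨ G.dir b c) ∧ b ∈ Z) ∨
      (G.dir a b ∧ G.dir c b ∧ ∀ d ∈ Z, ¬ G.IsAncestor b d))

/-- `Z` d-separates `x` and `y` in the DAG `G`. -/
def DSeparated (G : PDAG V) (x y : V) (Z : Set V) : Prop :=
  ∀ p, G.IsPath x y p → G.IsBlocked Z p

/-- Two DAGs are Markov equivalent if they induce the same d-separation relations. -/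
def MarkovEquivalent (G H : PDAG V) : Prop :=
  ∀ (x y : V) (Z : Set V), x ≠ y → x ∉ Z → y ∉ Z → (G.DSeparated x y Z ↔ H.DSeparated x y Z)

/-- `C` is the completed PDAG of the DAG `G`: it has the skeleton of `G`, and its directed edges are
those which appear in all DAGs equivalent to `G`. -/
def IsCPDAGOf (C G : PDAG V) : Prop :=
  C.SameSkeleton G ∧
    ∀ x y, C.dir x y ↔ ∀ G' : PDAG V, G'.IsDAG → MarkovEquivalent G G' → G'.dir x y

/-- `C` is a CPDAG, that is, the completed PDAG of some DAG. -/
def IsCPDAG (C : PDAG V) : Prop := ∃ G : PDAG V, G.IsDAG ∧ C.IsCPDAGOf G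

/-- The Markov equivalence class `[C]` represented by the CPDAG `C`: all DAGs that are Markov
equivalent to a DAG whose completed PDAG is `C`. -/
def markovClass (C : PDAG V) : Set (PDAG V) :=
  {G' | G'.IsDAG ∧ ∃ G : PDAG V, G.IsDAG ∧ C.IsCPDAGOf G ∧ MarkovEquivalent G G'}

end PDAG

/-- Pairwise causal constraints over `V`, given by their tail and their head. -/
inductive PairwiseConstraint (V : Type*) where
  /-- `x → y`: `x` is a parent of `y`. -/
  | direct (x y : V)
  /-- `x ⇢ y`: `x` is an ancestor of `y`. -/
  | ancestral (x y : V)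
  /-- `x` is not an ancestor of `y`. -/
  | nonAncestral (x y : V)

/-- The constraint is true for `G`. -/
def PairwiseConstraint.Holds {V : Type*} (G : PDAG V) : PairwiseConstraint V → Prop
  | .direct x y => G.dir x y
  | .ancestral x y => G.IsAncestor x y
  | .nonAncestral x y => ¬ G.IsAncestor x y

/-- A direct causal clause over `V`: the tail is a direct cause of at least one of the heads. -/
@[ext]
structure DCC (V : Type*) where
  tail : V
  heads : Set V
  tail_notMem : tail ∉ heads

/-- The clause holds for `G`. -/
def DCC.Holds {V : Type*} (G : PDAG V) (κ : DCC V) : Prop :=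
  (κ.heads ∩ G.children κ.tail).Nonempty

namespace PDAG

variable {V : Type*}

/-- The restricted Markov equivalence class `[C, B]` induced by a CPDAG `C` and a set `B` of
pairwise causal constraints. -/
def restrictedClass (C : PDAG V) (B : Set (PairwiseConstraint V)) : Set (PDAG V) :=
  {G | G ∈ C.markovClass ∧ ∀ b ∈ B, b.Holds G}

/-- `B` is consistent with the CPDAG `C`. -/
def IsConsistent (C : PDAG V) (B : Set (PairwiseConstraint V)) : Prop :=
  (C.restrictedClass B).Nonempty

/-- `H` is the MPDAG of the restricted Markov equivalence class `[C, B]`: it has the same skeleton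
and v-structures as `C`, and an edge is directed in `H` iff it appears in all DAGs in `[C, B]`. -/
def IsMPDAGOf (H C : PDAG V) (B : Set (PairwiseConstraint V)) : Prop :=
  H.SameSkeleton C ∧ H.SameVStructures C ∧
    ∀ x y, H.dir x y ↔ ∀ G ∈ C.restrictedClass B, G.dir x y

/-- The set `[H]` of DAGs which contain all directed edges of `H` and have the same skeleton and
v-structures as `H`. -/
def represented (H : PDAG V) : Set (PDAG V) :=
  {G | G.IsDAG ∧ (∀ x y, H.dir x y → G.dir x y) ∧ G.SameSkeleton H ∧ G.SameVStructures H}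

/-- The subset `[H, R]` of `[H]` consisting of the DAGs satisfying all clauses in `R`. -/
def representedWith (H : PDAG V) (R : Set (DCC V)) : Set (PDAG V) :=
  {G | G ∈ H.represented ∧ ∀ κ ∈ R, κ.Holds G}

end PDAG

namespace PDAG

variable {V : Type*} {G H : PDAG V} {Z : Set V}

/-! Inside a Markov equivalence class each constraint is a conjunction of clauses. Take a shortest
directed path from `x` to `y` in one DAG of the class. Its entries two steps apart are nonadjacent,
so in any other DAG of the class, once its first edge keeps its direction, reversing a later edge
would create a new v-structure. Hence `x` is an ancestor of `y` exactly when `x → c` for some `c` in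
`critical C x y`: a single clause. Non-ancestry says that every such edge points to `x`: clauses
with head set `{x}`.

Collecting these clauses gives `[C, B] = [H, R]`, provided membership in the class can be tested by
skeleton and v-structures. This is the Verma–Pearl theorem. One half uses separation by parent sets
(`dSeparated_parents`); the other shows that a suitably minimal active path of one DAG stays active
in the other (`IsMinActive.isActive_of_same`). Minimality of `R` then follows from finiteness. -/

theorem dir_asymm {x y : V} (h : G.dir x y) : ¬ G.dir y x := fun h' =>
  G.acyclic x (.tail (.single h) h')

theorem dir_irrefl (x : V) : ¬ G.dir x x := fun h => G.acyclic x (.single h)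

theorem dir_ne {x y : V} (h : G.dir x y) : x ≠ y := by
  rintro rfl
  exact dir_irrefl _ h

theorem Adj.symm {x y : V} (h : G.Adj x y) : G.Adj y x := by
  rcases h with h | h | h
  · exact .inr (.inl h)
  · exact .inl h
  · exact .inr (.inr (G.undir_symm _ _ h))

theorem IsDAG.adj_iff (hG : G.IsDAG) {x y : V} : G.Adj x y ↔ G.dir x y ∨ G.dir y x := by
  simp [Adj, hG x y]

theorem IsDAG.dir_trans (hG : G.IsDAG) {x y z : V} (hxy : G.dir x y) (hyz : G.dir y z)
    (h : G.Adj x z) : G.dir x z :=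
  (hG.adj_iff.1 h).resolve_right fun hzx => G.acyclic x (.tail (.tail (.single hxy) hyz) hzx)

theorem IsDAG.dir_of_not_dir (hG : G.IsDAG) {x y : V} (h : G.Adj x y) (h' : ¬ G.dir y x) :
    G.dir x y :=
  (hG.adj_iff.1 h).resolve_right h'

theorem SameSkeleton.symm (h : G.SameSkeleton H) : H.SameSkeleton G := fun x y => (h x y).symm

theorem SameSkeleton.trans {K : PDAG V} (h : G.SameSkeleton H) (h' : H.SameSkeleton K) :
    G.SameSkeleton K := fun x y => (h x y).trans (h' x y)

theorem SameVStructures.symm (h : G.SameVStructures H) : H.SameVStructures G :=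
  fun x y z => (h x y z).symm

theorem SameVStructures.trans {K : PDAG V} (h : G.SameVStructures H)
    (h' : H.SameVStructures K) : G.SameVStructures K := fun x y z => (h x y z).trans (h' x y z)

/-! ### Distance to a set along directed paths -/

/-- There is a directed walk of length `n` from `v` into `Z`. -/
def Reaches (G : PDAG V) (Z : Set V) : ℕ → V → Prop
  | 0, v => v ∈ Z
  | n + 1, v => ∃ w, G.dir v w ∧ Reaches G Z n w

/-- The set of ancestors of the elements of `Z`. -/
def ancestors (G : PDAG V) (Z : Set V) : Set V := {v | ∃ z ∈ Z, G.IsAncestor v z}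

theorem mem_ancestors_of_dir {v w : V} (h : G.dir v w) (hw : w ∈ G.ancestors Z) :
    v ∈ G.ancestors Z := by
  obtain ⟨z, hz, hwz⟩ := hw
  exact ⟨z, hz, .head h hwz⟩

theorem mem_ancestors_of_mem {v : V} (h : v ∈ Z) : v ∈ G.ancestors Z := ⟨v, h, .refl⟩

theorem mem_ancestors_iff {v : V} : v ∈ G.ancestors Z ↔ ∃ n, G.Reaches Z n v := by
  constructor
  · rintro ⟨z, hz, h⟩
    induction h using Relation.ReflTransGen.head_induction_on with
    | refl => exact ⟨0, hz⟩
    | head h _ ih =>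
      obtain ⟨n, hn⟩ := ih
      exact ⟨n + 1, _, h, hn⟩
  · rintro ⟨n, hn⟩
    induction n generalizing v with
    | zero => exact mem_ancestors_of_mem hn
    | succ n ih =>
      obtain ⟨w, hvw, hw⟩ := hn
      exact mem_ancestors_of_dir hvw (ih hw)

/-- The length of a shortest directed path from `v` into `Z`. -/
noncomputable def distTo (G : PDAG V) (Z : Set V) (v : V) : ℕ := sInf {n | G.Reaches Z n v}

theorem distTo_le_of_dir {v w : V} (h : G.dir v w) (hw : w ∈ G.ancestors Z) :
    G.distTo Z v ≤ G.distTo Z w + 1 :=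
  Nat.sInf_le ⟨w, h, Nat.sInf_mem (mem_ancestors_iff.1 hw)⟩

theorem mem_or_exists_distTo {v : V} (hv : v ∈ G.ancestors Z) :
    v ∈ Z ∨ ∃ w, G.dir v w ∧ w ∈ G.ancestors Z ∧ G.distTo Z v = G.distTo Z w + 1 := by
  have h : G.Reaches Z (G.distTo Z v) v := Nat.sInf_mem (mem_ancestors_iff.1 hv)
  rcases hn : G.distTo Z v with _ | n
  · rw [hn] at h
    exact .inl h
  · rw [hn] at h
    obtain ⟨w, hvw, hw⟩ := h
    have hw' : w ∈ G.ancestors Z := mem_ancestors_iff.2 ⟨n, hw⟩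
    refine .inr ⟨w, hvw, hw', ?_⟩
    have h1 : G.distTo Z w ≤ n := Nat.sInf_le hw
    have h2 := distTo_le_of_dir hvw hw'
    lia

/-- If the first edge of a shortest directed path into `Z` has the same orientation in a graph with
the same skeleton and v-structures, then so has the whole path. -/
theorem mem_ancestors_of_first_edge (hG : G.IsDAG) (hH : H.IsDAG) (hs : G.SameSkeleton H)
    (hv : G.SameVStructures H) {v w : V} (hvw : G.dir v w) (hw : w ∈ G.ancestors Z)
    (hd : G.distTo Z v = G.distTo Z w + 1) (hvw' : H.dir v w) : w ∈ H.ancestors Z := by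
  induction hn : G.distTo Z w generalizing v w with
  | zero =>
    rcases mem_or_exists_distTo hw with h | ⟨u, -, -, h⟩
    · exact mem_ancestors_of_mem h
    · lia
  | succ n ih =>
    rcases mem_or_exists_distTo hw with h | ⟨u, hwu, hu, h⟩
    · exact mem_ancestors_of_mem h
    have hwu' : H.dir w u := by
      -- Otherwise `v → w ← u` would be a v-structure of `H` only: adjacency of `v` and `u` would
      -- shorten the path.
      refine hH.dir_of_not_dir ((hs _ _).1 (.inl hwu)) fun huw => ?_
      have hadj : ¬ G.Adj v u := fun hvu => by
        have := distTo_le_of_dir (hG.dir_trans hvw hwu hvu) hu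
        lia
      have hne : v ≠ u := by
        rintro rfl
        exact dir_asymm hvw hwu
      have := (hv v w u).2 ⟨hne, hvw', huw, fun h => hadj ((hs _ _).2 h)⟩
      exact dir_asymm hwu this.2.2.1
    exact mem_ancestors_of_dir hwu' (ih hwu hu h hwu' (by lia))

/-! ### Consecutive triples of a list -/

/-- `P` holds for all triples of consecutive entries of the list. -/
def Triples (P : V → V → V → Prop) (p : List V) : Prop :=
  ∀ a b c, [a, b, c] <:+: p → P a b c

theorem triples_cons {P : V → V → V → Prop} {a b : V} {r : List V} :
    Triples P (a :: b :: r) ↔ (∀ c ∈ r.head?, P a b c) ∧ Triples P (b :: r) := by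
  constructor
  · refine fun h => ⟨fun c hc => h a b c ?_, fun x y z hi => h x y z (hi.trans ?_)⟩
    · obtain ⟨r', rfl⟩ : ∃ r', r = c :: r' := by cases r <;> simp_all
      exact ⟨[], r', rfl⟩
    · exact (List.suffix_cons _ _).isInfix
  · rintro ⟨h1, h2⟩ x y z hi
    rcases List.infix_cons_iff.1 hi with hi | hi
    · obtain ⟨t, ht⟩ := hi
      simp only [List.cons_append, List.nil_append, List.cons.injEq] at ht
      obtain ⟨rfl, rfl, rfl⟩ := ht
      exact h1 z (by simp)
    · exact h2 x y z hi

theorem triples_singleton {P : V → V → V → Prop} (a : V) : Triples P [a] := fun x y z h => by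
  have := h.length_le
  simp at this

/-- Cutting between `a` and `c` loses only the two triples that straddle the cut. -/
theorem triples_append {P : V → V → V → Prop} {a c : V} {l r : List V} :
    Triples P (l ++ a :: c :: r) ↔ Triples P (l ++ [a]) ∧ Triples P (c :: r) ∧
      (∀ u ∈ l.getLast?, P u a c) ∧ ∀ w ∈ r.head?, P a c w := by
  induction l with
  | nil =>
    simp only [List.nil_append, triples_cons, List.getLast?_nil]
    have := triples_singleton (P := P) a
    simp only [this]
    simp [and_comm]
  | cons x l ih =>
    cases l with
    | nil =>
      simp only [List.cons_append, List.nil_append, triples_cons (r := c :: r),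
        triples_cons (r := []), triples_cons (a := a)]
      have := triples_singleton (P := P) a
      simp only [this]
      simp
      tauto
    | cons y l =>
      simp only [List.cons_append] at ih
      simp only [List.cons_append, triples_cons (a := x), ih]
      have h1 : (l ++ a :: c :: r).head? = (l ++ [a]).head? := by cases l <;> simp
      rw [h1, List.getLast?_cons_cons]
      tauto

theorem triples_reverse {P : V → V → V → Prop} {p : List V} :
    Triples P p.reverse ↔ Triples (fun a b c => P c b a) p := by
  constructor
  · intro h a b c hi
    exact h c b a (by simpa using List.reverse_infix.2 hi)
  · intro h a b c hi
    exact h c b a (by simpa using List.reverse_infix.2 hi)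

/-! ### Active paths -/

/-- The triple `(a, b, c)` does not block a path, given `Z`. -/
def Open (G : PDAG V) (Z : Set V) (a b c : V) : Prop :=
  (G.dir b a ∨ G.dir b c → b ∉ Z) ∧ (G.dir a b → G.dir c b → b ∈ G.ancestors Z)

theorem open_comm {a b c : V} : G.Open Z a b c ↔ G.Open Z c b a := by
  unfold Open
  tauto

theorem not_isBlocked_iff {p : List V} : ¬ G.IsBlocked Z p ↔ Triples (G.Open Z) p := by
  simp only [IsBlocked, Triples, Open, ancestors, Set.mem_ofPred_eq]
  push Not
  refine forall_congr' fun a => forall_congr' fun b => forall_congr' fun c =>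
    imp_congr_right fun _ => ?_
  tauto

/-- A path that is not blocked. -/
def IsActive (G : PDAG V) (Z : Set V) (x y : V) (p : List V) : Prop :=
  G.IsPath x y p ∧ Triples (G.Open Z) p

theorem dSeparated_iff {x y : V} : G.DSeparated x y Z ↔ ∀ p, ¬ G.IsActive Z x y p := by
  simp only [DSeparated, IsActive, ← not_isBlocked_iff]
  refine forall_congr' fun _ => ?_
  tauto

theorem IsPath.reverse {x y : V} {p : List V} (h : G.IsPath x y p) : G.IsPath y x p.reverse := by
  obtain ⟨h1, h2, h3, h4⟩ := h
  refine ⟨List.nodup_reverse.2 h1, ?_, by simpa using h4, by simpa using h3⟩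
  rw [List.isChain_reverse]
  exact h2.imp fun _ _ h => Adj.symm h

theorem IsActive.reverse {x y : V} {p : List V} (h : G.IsActive Z x y p) :
    G.IsActive Z y x p.reverse := by
  refine ⟨h.1.reverse, triples_reverse.2 fun a b c hi => open_comm.1 (h.2 a b c hi)⟩

theorem DSeparated.symm {x y : V} (h : G.DSeparated x y Z) : G.DSeparated y x Z :=
  dSeparated_iff.2 fun _ hp => dSeparated_iff.1 h _ hp.reverse

theorem isChain_splice {R : V → V → Prop} {l m m' r : List V} {a c : V}
    (h : (l ++ a :: (m ++ c :: r)).IsChain R) (h' : (a :: (m' ++ [c])).IsChain R) :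
    (l ++ a :: (m' ++ c :: r)).IsChain R := by
  have e (k : List V) : l ++ a :: (k ++ c :: r) = l ++ a :: k ++ c :: r := by simp
  rw [e, List.isChain_split] at h ⊢
  simp only [List.append_assoc, List.cons_append] at h ⊢
  rw [List.isChain_split] at h ⊢
  exact ⟨⟨h.1.1, h'⟩, h.2⟩

theorem IsPath.splice {x y a c : V} {l m m' r : List V}
    (h : G.IsPath x y (l ++ a :: (m ++ c :: r))) (h' : (a :: (m' ++ [c])).IsChain G.Adj)
    (hn : (l ++ a :: (m' ++ c :: r)).Nodup) : G.IsPath x y (l ++ a :: (m' ++ c :: r)) := by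
  obtain ⟨-, h2, h3, h4⟩ := h
  refine ⟨hn, isChain_splice h2 h', ?_, ?_⟩
  · rw [← h3]
    cases l <;> rfl
  · rw [← h4]
    simp [List.getLast?_append, List.getLast?_cons]

/-- Removing a section of an active path between two adjacent vertices. -/
theorem IsActive.shortcut {x y a c : V} {l m r : List V}
    (h : G.IsActive Z x y (l ++ a :: (m ++ c :: r))) (hac : G.Adj a c)
    (hl : ∀ u ∈ l.getLast?, G.Open Z u a c) (hr : ∀ w ∈ r.head?, G.Open Z a c w) :
    G.IsActive Z x y (l ++ a :: c :: r) := by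
  refine ⟨h.1.splice (m' := []) (by simpa using hac) (h.1.1.sublist ?_), ?_⟩
  · simp
  · refine triples_append.2 ⟨?_, ?_, hl, hr⟩
    · exact fun u v w hi => h.2 u v w (hi.trans ⟨[], m ++ c :: r, by simp⟩)
    · exact fun u v w hi => h.2 u v w (hi.trans ⟨l ++ a :: m, [], by simp⟩)

/-- An active path of minimal length and, for this length, with minimal total distance to `Z`. -/
structure IsMinActive (G : PDAG V) (Z : Set V) (x y : V) (p : List V) : Prop where
  isActive : G.IsActive Z x y p
  length_le : ∀ q, G.IsActive Z x y q → p.length ≤ q.length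
  sum_le : ∀ q, G.IsActive Z x y q → q.length = p.length →
    (p.map (G.distTo Z)).sum ≤ (q.map (G.distTo Z)).sum

theorem IsMinActive.reverse {x y : V} {p : List V} (h : G.IsMinActive Z x y p) :
    G.IsMinActive Z y x p.reverse where
  isActive := h.isActive.reverse
  length_le q hq := by simpa using h.length_le _ hq.reverse
  sum_le q hq hl := by
    simpa [List.sum_reverse] using h.sum_le _ hq.reverse (by simpa using hl)

theorem IsActive.exists_isMinActive {x y : V} {p : List V} (h : G.IsActive Z x y p) :
    ∃ q, G.IsMinActive Z x y q := by
  obtain ⟨q, hq, hmin⟩ := (measure List.length).wf.has_min {q | G.IsActive Z x y q} ⟨p, h⟩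
  obtain ⟨q', ⟨hq', hl⟩, hmin'⟩ := (measure fun s : List V => (s.map (G.distTo Z)).sum).wf.has_min
    {s | G.IsActive Z x y s ∧ s.length = q.length} ⟨q, hq, rfl⟩
  exact ⟨q', hq', fun s hs => hl ▸ not_lt.1 (hmin s hs),
    fun s hs hsl => not_lt.1 (hmin' s ⟨hs, hsl.trans hl⟩)⟩

/-- By minimality, skipping `b` must block the path. The status of `c` never causes this, so `a`
must change from a collider in `Z` to a non-collider. -/
theorem IsMinActive.triple_of_dir (hG : G.IsDAG) {x y a b c : V} {l r : List V}
    (h : G.IsMinActive Z x y (l ++ a :: b :: c :: r)) (hac : G.dir a c) :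
    G.dir b a ∧ G.dir b c ∧ ∃ u ∈ l.getLast?, G.dir u a ∧ a ∈ Z := by
  have h0 := h.isActive
  have hch := h0.1.2.1
  rw [List.isChain_split] at hch
  simp only [List.isChain_cons_cons] at hch
  obtain ⟨hch1, hab, hbc, hch2⟩ := hch
  have ht1 := triples_append.1 h0.2
  have ht2 := (triples_append (l := l ++ [a]) (a := b) (c := c) (r := r)).1 (by simpa using h0.2)
  by_contra hcon
  have key : G.IsActive Z x y (l ++ a :: c :: r) := by
    refine IsActive.shortcut (m := [b]) h0 (.inl hac) (fun u hu => ⟨fun _ => ?_, fun _ hca => ?_⟩)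
      fun w hw => ⟨fun hc => ?_, fun _ hwc => ?_⟩
    · have ho := ht1.2.2.1 u hu
      by_cases hab' : G.dir a b
      · exact ho.1 (.inr hab')
      have hba := hG.dir_of_not_dir hab.symm hab'
      intro haZ
      have hau : ¬ G.dir a u := fun hau => ho.1 (.inl hau) haZ
      have hadj : G.Adj u a := by
        obtain ⟨l', rfl⟩ : ∃ l', l = l' ++ [u] := by
          rw [Option.mem_def, List.getLast?_eq_some_iff] at hu
          exact hu
        have := hch1
        simp only [List.append_assoc, List.cons_append, List.nil_append] at this
        rw [List.isChain_split] at this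
        simpa using this.2
      exact hcon ⟨hba, hG.dir_trans hba hac hbc, u, hu, hG.dir_of_not_dir hadj hau, haZ⟩
    · exact (dir_asymm hac hca).elim
    · exact (ht2.2.2.2 w hw).1 (.inr (hc.resolve_left (dir_asymm hac)))
    · by_cases hbc' : G.dir b c
      · exact (ht2.2.2.2 w hw).2 hbc' hwc
      have hcb := hG.dir_of_not_dir hbc.symm hbc'
      exact mem_ancestors_of_dir hcb
        ((ht1.2.2.2 c (by simp)).2 (hG.dir_trans hac hcb hab) hcb)
  have := h.length_le _ key
  simp at this

theorem IsMinActive.triple_of_adj (hG : G.IsDAG) {x y a b c : V} {l r : List V}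
    (h : G.IsMinActive Z x y (l ++ a :: b :: c :: r)) (hac : G.Adj a c) :
    G.dir b a ∧ G.dir b c := by
  rcases hG.adj_iff.1 hac with hac | hca
  · have := h.triple_of_dir hG hac
    exact ⟨this.1, this.2.1⟩
  · have := IsMinActive.triple_of_dir hG (x := y) (y := x) (l := r.reverse) (r := l.reverse)
      (a := c) (b := b) (c := a) (Z := Z) (by simpa using h.reverse) hca
    exact ⟨this.2.1, this.1⟩

/-- The collider `u → a ← b` is unshielded, so it persists in `H`. Since `u` and `c` are
nonadjacent, `a → c` persists too, and acyclicity forces `b → c`. -/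
theorem IsMinActive.triple_of_dir' (hG : G.IsDAG) (hH : H.IsDAG) (hs : G.SameSkeleton H)
    (hv : G.SameVStructures H) {x y a b c : V} {l r : List V}
    (h : G.IsMinActive Z x y (l ++ a :: b :: c :: r)) (hac : G.dir a c) :
    H.dir b a ∧ H.dir b c := by
  obtain ⟨hba, hbc, u, hu, hua, haZ⟩ := h.triple_of_dir hG hac
  obtain ⟨l, rfl⟩ : ∃ l', l = l' ++ [u] := by
    rw [Option.mem_def, List.getLast?_eq_some_iff] at hu
    exact hu
  have h : G.IsMinActive Z x y (l ++ u :: a :: b :: c :: r) := by simpa using h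
  have hub : ¬ G.Adj u b := fun hub => dir_asymm hua (h.triple_of_adj hG hub).1
  have hnd := h.isActive.1.1.sublist (List.sublist_append_right _ _)
  simp only [List.nodup_cons, List.mem_cons, not_or] at hnd
  have hvs := (hv u a b).1 ⟨hnd.1.2.1, hua, hba, hub⟩
  have huc : ¬ G.Adj u c := fun huc => by
    have huc' := hG.dir_trans hua hac huc
    have h0 := h.isActive
    have ht1 := triples_append.1 h0.2
    have ht2 := (triples_append (l := l ++ [u, a]) (a := b) (c := c) (r := r)).1
      (by simpa using h0.2)
    -- If `u` and `c` were adjacent, both `a` and `b` could be skipped.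
    have key : G.IsActive Z x y (l ++ u :: c :: r) := by
      refine IsActive.shortcut (m := [a, b]) h0 huc (fun t ht => ⟨fun _ => ?_, fun _ hcu => ?_⟩)
        fun w hw => ⟨fun hc => ?_, fun _ hwc => ?_⟩
      · exact (ht1.2.2.1 t ht).1 (.inr hua)
      · exact (dir_asymm huc' hcu).elim
      · exact (ht2.2.2.2 w hw).1 (.inr (hc.resolve_left (dir_asymm huc')))
      · exact (ht2.2.2.2 w hw).2 hbc hwc
    have := h.length_le _ key
    simp at this
  have hac' : H.dir a c := by
    refine hH.dir_of_not_dir ((hs _ _).1 (.inl hac)) fun hca => ?_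
    have := (hv u a c).2 ⟨hnd.1.2.2.1, hvs.2.1, hca, fun h => huc ((hs _ _).2 h)⟩
    exact dir_asymm hac this.2.2.1
  exact ⟨hvs.2.2.1, hH.dir_trans hvs.2.2.1 hac' ((hs _ _).1 (.inl hbc))⟩

theorem IsMinActive.triple_of_adj' (hG : G.IsDAG) (hH : H.IsDAG) (hs : G.SameSkeleton H)
    (hv : G.SameVStructures H) {x y a b c : V} {l r : List V}
    (h : G.IsMinActive Z x y (l ++ a :: b :: c :: r)) (hac : G.Adj a c) :
    H.dir b a ∧ H.dir b c := by
  rcases hG.adj_iff.1 hac with hac | hca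
  · exact h.triple_of_dir' hG hH hs hv hac
  · exact (IsMinActive.triple_of_dir' hG hH hs hv (x := y) (y := x) (l := r.reverse)
      (r := l.reverse) (a := c) (b := b) (c := a) (Z := Z) (by simpa using h.reverse) hca).symm

/-- A common child of the neighbours of a collider does not come later on a minimal path. -/
theorem IsMinActive.notMem_right {x y a b c d : V} {l r : List V}
    (h : G.IsMinActive Z x y (l ++ a :: b :: c :: r)) (hab : G.dir a b) (had : G.dir a d)
    (hd : d ∈ G.ancestors Z) : d ∉ r := by
  intro hdr
  obtain ⟨s, r, rfl⟩ := List.append_of_mem hdr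
  have h0 := h.isActive
  have ht1 := triples_append.1 h0.2
  have key : G.IsActive Z x y (l ++ a :: d :: r) := by
    refine IsActive.shortcut (m := b :: c :: s) h0 (.inl had)
      (fun t ht => ⟨fun _ => ?_, fun _ hda => ?_⟩) fun w hw => ⟨fun hc => ?_, fun _ _ => hd⟩
    · exact (ht1.2.2.1 t ht).1 (.inr hab)
    · exact (dir_asymm had hda).elim
    · have hdw := hc.resolve_left (dir_asymm had)
      obtain ⟨r, rfl⟩ : ∃ r', r = w :: r' := by cases r <;> simp_all
      obtain ⟨s', e, hs'⟩ : ∃ s' e, c :: s = s' ++ [e] :=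
        ⟨_, _, (List.dropLast_append_getLast (List.cons_ne_nil c s)).symm⟩
      refine (h0.2 e d w ⟨l ++ a :: b :: s', r, ?_⟩).1 (.inr hdw)
      have : c :: (s ++ d :: w :: r) = s' ++ e :: d :: w :: r := by
        rw [← List.cons_append, hs']
        simp
      simp [this]
  have := h.length_le _ key
  simp at this
  lia

/-- Let `d` follow `b` on a shortest directed path into `Z`. If `H` reverses `b → d`, then `d` can
replace `b` on the active path, with smaller total distance to `Z`. -/
theorem IsMinActive.collider_mem_ancestors (hG : G.IsDAG) (hH : H.IsDAG) (hs : G.SameSkeleton H)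
    (hv : G.SameVStructures H) {x y a b c : V} {l r : List V}
    (h : G.IsMinActive Z x y (l ++ a :: b :: c :: r)) (hab : G.dir a b) (hcb : G.dir c b) :
    b ∈ H.ancestors Z := by
  have h0 := h.isActive
  have ht1 := triples_append.1 h0.2
  have ht2 := (triples_append (l := l ++ [a]) (a := b) (c := c) (r := r)).1 (by simpa using h0.2)
  have hac : ¬ G.Adj a c := fun hac => dir_asymm hab (h.triple_of_adj hG hac).1
  have hnd := h0.1.1.sublist (List.sublist_append_right _ _)
  simp only [List.nodup_cons, List.mem_cons, not_or] at hnd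
  have hvs := (hv a b c).1 ⟨hnd.1.2.1, hab, hcb, hac⟩
  rcases mem_or_exists_distTo ((ht1.2.2.2 c (by simp)).2 hab hcb) with hb | ⟨d, hbd, hd, hdist⟩
  · exact mem_ancestors_of_mem hb
  by_cases hbd' : H.dir b d
  · exact mem_ancestors_of_dir hbd' (mem_ancestors_of_first_edge hG hH hs hv hbd hd hdist hbd')
  have hdb := hH.dir_of_not_dir ((hs _ _).1 (.inr (.inl hbd))) hbd'
  -- Were `e` and `d` nonadjacent, `e → b ← d` would be a v-structure of `H` but not of `G`.
  have hdir : ∀ e, G.dir e b → H.dir e b → G.dir e d := by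
    intro e heb heb'
    refine hG.dir_trans heb hbd ?_
    by_contra hed
    have hne : e ≠ d := by
      rintro rfl
      exact dir_asymm heb hbd
    have := (hv e b d).2 ⟨hne, heb', hdb, fun h => hed ((hs _ _).2 h)⟩
    exact dir_asymm hbd this.2.2.1
  have had := hdir a hab hvs.2.1
  have hcd := hdir c hcb hvs.2.2.1
  have hdr : d ∉ r := h.notMem_right hab had hd
  have hdl : d ∉ l := by
    have := IsMinActive.notMem_right (x := y) (y := x) (l := r.reverse) (r := l.reverse)
      (a := c) (b := b) (c := a) (Z := Z) (by simpa using h.reverse) hcb hcd hd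
    simpa using this
  have hnd' : (l ++ a :: ([d] ++ c :: r)).Nodup := by
    have h1 := h0.1.1
    have n1 := dir_ne had
    have n2 := dir_ne hcd
    simp only [List.nodup_append, List.nodup_cons, List.mem_cons, List.cons_append,
      List.nil_append, not_or, ne_eq, forall_eq_or_imp] at h1 ⊢
    grind
  have key : G.IsActive Z x y (l ++ a :: ([d] ++ c :: r)) := by
    refine ⟨IsPath.splice (m := [b]) h0.1 ?_ hnd', ?_⟩
    · simp [Adj, had, hcd]
    · refine triples_append.2 ⟨ht1.1, triples_cons.2 ⟨fun w hw => ?_, ht2.2.1⟩, fun u hu => ?_, ?_⟩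
      · exact ⟨fun _ => (ht2.2.2.2 w hw).1 (.inl hcb), fun hdc => (dir_asymm hcd hdc).elim⟩
      · exact ⟨fun _ => (ht1.2.2.1 u hu).1 (.inr hab), fun _ hda => (dir_asymm had hda).elim⟩
      · intro w hw
        obtain rfl : c = w := by simpa using hw
        exact ⟨fun h => (h.elim (dir_asymm had) (dir_asymm hcd)).elim, fun _ _ => hd⟩
  have := h.sum_le _ key (by simp)
  simp only [List.map_append, List.map_cons, List.sum_append, List.sum_cons, List.map_nil,
    List.sum_nil] at this
  lia

theorem IsMinActive.isActive_of_same (hG : G.IsDAG) (hH : H.IsDAG) (hs : G.SameSkeleton H)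
    (hv : G.SameVStructures H) {x y : V} {p : List V} (h : G.IsMinActive Z x y p) :
    H.IsActive Z x y p := by
  obtain ⟨⟨h1, h2, h3, h4⟩, h5⟩ := h.isActive
  refine ⟨⟨h1, h2.imp fun a b => (hs a b).1, h3, h4⟩, ?_⟩
  intro a b c hi
  have ho := h5 a b c hi
  have hadj := h2.infix hi
  simp only [List.isChain_cons_cons, List.isChain_singleton, and_true] at hadj
  have hnd := h1.sublist hi.sublist
  simp only [List.nodup_cons, List.mem_cons, List.not_mem_nil, not_or] at hnd
  obtain ⟨l, r, rfl⟩ := hi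
  have h' : G.IsMinActive Z x y (l ++ a :: b :: c :: r) := by simpa using h
  -- Shielded triples are forks in both DAGs; unshielded ones are governed by the v-structures.
  by_cases hac : G.Adj a c
  · have hg := h'.triple_of_adj hG hac
    have hh := h'.triple_of_adj' hG hH hs hv hac
    exact ⟨fun _ => ho.1 (.inl hg.1), fun hab => (dir_asymm hab hh.1).elim⟩
  have hac' : ¬ H.Adj a c := fun h => hac ((hs _ _).2 h)
  refine ⟨fun hor => ho.1 ?_, fun hab hcb => ?_⟩
  · by_contra hcon
    push Not at hcon
    have := (hv a b c).1 ⟨hnd.1.2.1, hG.dir_of_not_dir hadj.1 hcon.1,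
      hG.dir_of_not_dir hadj.2.symm hcon.2, hac⟩
    exact hor.elim (dir_asymm this.2.1) (dir_asymm this.2.2.1)
  · have := (hv a b c).2 ⟨hnd.1.2.1, hab, hcb, hac'⟩
    exact h'.collider_mem_ancestors hG hH hs hv this.2.1 this.2.2.1

theorem DSeparated.of_same (hG : G.IsDAG) (hH : H.IsDAG) (hs : G.SameSkeleton H)
    (hv : G.SameVStructures H) {x y : V} (h : H.DSeparated x y Z) : G.DSeparated x y Z := by
  rw [dSeparated_iff] at h ⊢
  intro p hp
  obtain ⟨q, hq⟩ := hp.exists_isMinActive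
  exact h q (hq.isActive_of_same hG hH hs hv)

theorem MarkovEquivalent.of_same (hG : G.IsDAG) (hH : H.IsDAG) (hs : G.SameSkeleton H)
    (hv : G.SameVStructures H) : MarkovEquivalent G H := fun _ _ _ _ _ _ =>
  ⟨.of_same hH hG hs.symm hv.symm, .of_same hG hH hs hv⟩

/-! ### Markov equivalent DAGs have the same skeleton and v-structures -/

/-- Without a collider the walk would stay directed and make `x` an ancestor of `y`. The first
collider is still a descendant of `x`. -/
theorem exists_collider (hG : G.IsDAG) {x y u v : V} {t : List V} (hxy : ¬ G.IsAncestor x y)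
    (huv : G.dir u v) (hxv : Relation.TransGen G.dir x v) (ht : (u :: v :: t).IsChain G.Adj)
    (hy : (v :: t).getLast? = some y) :
    ∃ a b c, [a, b, c] <:+: u :: v :: t ∧ G.dir a b ∧ G.dir c b ∧
      Relation.TransGen G.dir x b := by
  induction t generalizing u v with
  | nil =>
    obtain rfl : v = y := by simpa using hy
    exact (hxy hxv.to_reflTransGen).elim
  | cons w t ih =>
    simp only [List.isChain_cons_cons] at ht
    by_cases hwv : G.dir w v
    · exact ⟨u, v, w, ⟨[], t, rfl⟩, huv, hwv, hxv⟩
    have hvw := hG.dir_of_not_dir ht.2.1 hwv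
    obtain ⟨a, b, c, hi, h⟩ := ih hvw (hxv.tail hvw) (by simpa using ht.2)
      (by simpa [List.getLast?_cons_cons] using hy)
    exact ⟨a, b, c, hi.trans (List.suffix_cons _ _).isInfix, h⟩

/-- A path entering `x` is blocked at a parent of `x`. A path leaving `x` has a collider below `x`,
which cannot be an ancestor of a parent of `x`. -/
theorem dSeparated_parents (hG : G.IsDAG) {x y : V} (hne : x ≠ y) (hadj : ¬ G.Adj x y)
    (hxy : ¬ G.IsAncestor x y) : G.DSeparated x y {z | G.dir z x} := by
  rintro p ⟨-, hch, hx, hy⟩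
  obtain ⟨t, rfl⟩ : ∃ t, p = x :: t := by cases p <;> simp_all
  obtain _ | ⟨v, t⟩ := t
  · simp at hy
    exact (hne hy).elim
  rw [List.getLast?_cons_cons] at hy
  by_cases hvx : G.dir v x
  · obtain _ | ⟨w, t⟩ := t
    · simp at hy
      subst hy
      exact (hadj (.inr (.inl hvx))).elim
    · exact ⟨x, v, w, ⟨[], t, rfl⟩, .inl ⟨.inl hvx, hvx⟩⟩
  have hxv := hG.dir_of_not_dir (List.isChain_cons_cons.1 hch).1 hvx
  obtain ⟨a, b, c, hi, hab, hcb, hxb⟩ := exists_collider hG hxy hxv (.single hxv) hch hy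
  refine ⟨a, b, c, hi, .inr ⟨hab, hcb, fun d hd hbd => ?_⟩⟩
  exact G.acyclic x ((hxb.trans_left hbd).tail hd)

theorem exists_dSeparated (hG : G.IsDAG) {x y : V} (hne : x ≠ y) (hadj : ¬ G.Adj x y) :
    ∃ Z : Set V, x ∉ Z ∧ y ∉ Z ∧ G.DSeparated x y Z := by
  by_cases hxy : G.IsAncestor x y
  · refine ⟨{z | G.dir z y}, fun h => hadj (.inl h), dir_irrefl y, ?_⟩
    refine (dSeparated_parents hG hne.symm (fun h => hadj h.symm) fun hyx => ?_).symm
    rcases Relation.reflTransGen_iff_eq_or_transGen.1 hxy with h | h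
    · exact hne h.symm
    · exact G.acyclic x (h.trans_left hyx)
  · exact ⟨{z | G.dir z x}, dir_irrefl x, fun h => hadj (.inr (.inl h)),
      dSeparated_parents hG hne hadj hxy⟩

theorem not_dSeparated_of_adj {x y : V} (hne : x ≠ y) (h : G.Adj x y) :
    ¬ G.DSeparated x y Z := fun hd => by
  obtain ⟨a, b, c, hi, -⟩ := hd [x, y] ⟨by simpa using hne, by simpa using h, rfl, rfl⟩
  have := hi.length_le
  simp at this

theorem IsDAG.adj_ne (hG : G.IsDAG) {x y : V} (h : G.Adj x y) : x ≠ y := by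
  rcases hG.adj_iff.1 h with h | h
  · exact dir_ne h
  · exact (dir_ne h).symm

theorem MarkovEquivalent.symm (h : MarkovEquivalent G H) : MarkovEquivalent H G :=
  fun x y Z h1 h2 h3 => (h x y Z h1 h2 h3).symm

theorem MarkovEquivalent.adj (hG : G.IsDAG) (hH : H.IsDAG) (h : MarkovEquivalent G H) {x y : V}
    (hxy : G.Adj x y) : H.Adj x y := by
  by_contra hn
  obtain ⟨Z, hx, hy, hd⟩ := exists_dSeparated hH (hG.adj_ne hxy) hn
  exact not_dSeparated_of_adj (hG.adj_ne hxy) hxy ((h x y Z (hG.adj_ne hxy) hx hy).2 hd)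

theorem MarkovEquivalent.sameSkeleton (hG : G.IsDAG) (hH : H.IsDAG) (h : MarkovEquivalent G H) :
    G.SameSkeleton H := fun _ _ => ⟨h.adj hG hH, h.symm.adj hH hG⟩

theorem infix_triple {a b c x y z : V} (h : [a, b, c] <:+: [x, y, z]) :
    a = x ∧ b = y ∧ c = z := by
  simpa using h.eq_of_length rfl

/-- A set separating `x` and `z` in `G` must omit the collider `y`; in `H` it blocks the same path,
so `y` is a collider there too. -/
theorem MarkovEquivalent.isVStructure (hG : G.IsDAG) (hH : H.IsDAG) (h : MarkovEquivalent G H)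
    {x y z : V} (hv : G.IsVStructure x y z) : H.IsVStructure x y z := by
  obtain ⟨hne, hxy, hzy, hxz⟩ := hv
  have hs := h.sameSkeleton hG hH
  obtain ⟨Z, hx, hz, hd⟩ := exists_dSeparated hG hne hxz
  have hnd : [x, y, z].Nodup := by simp [hne, dir_ne hxy, (dir_ne hzy).symm]
  have hch : [x, y, z].IsChain G.Adj := by simp [Adj, hxy, hzy]
  have hy : y ∉ Z := by
    obtain ⟨a, b, c, hi, hb⟩ := hd [x, y, z] ⟨hnd, hch, rfl, rfl⟩
    obtain ⟨rfl, rfl, rfl⟩ := infix_triple hi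
    rcases hb with ⟨hb, -⟩ | ⟨-, -, hb⟩
    · exact (hb.elim (dir_asymm hxy) (dir_asymm hzy)).elim
    · exact fun hZ => hb _ hZ .refl
  obtain ⟨a, b, c, hi, hb⟩ := (h x z Z hne hx hz).1 hd [x, y, z]
    ⟨hnd, hch.imp fun a b => (hs a b).1, rfl, rfl⟩
  obtain ⟨rfl, rfl, rfl⟩ := infix_triple hi
  rcases hb with ⟨-, hb⟩ | ⟨h1, h2, -⟩
  · exact (hy hb).elim
  · exact ⟨hne, h1, h2, fun h => hxz ((hs _ _).2 h)⟩

theorem MarkovEquivalent.sameVStructures (hG : G.IsDAG) (hH : H.IsDAG)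
    (h : MarkovEquivalent G H) : G.SameVStructures H :=
  fun _ _ _ => ⟨h.isVStructure hG hH, h.symm.isVStructure hH hG⟩

/-! ### Markov equivalence classes -/

theorem IsCPDAGOf.sameVStructures {C : PDAG V} (hG : G.IsDAG) (h : C.IsCPDAGOf G) :
    C.SameVStructures G := by
  intro x y z
  constructor
  · rintro ⟨hne, hxy, hzy, hxz⟩
    exact ⟨hne, (h.2 x y).1 hxy G hG fun _ _ _ _ _ _ => .rfl,
      (h.2 z y).1 hzy G hG fun _ _ _ _ _ _ => .rfl, fun h' => hxz ((h.1 _ _).2 h')⟩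
  · rintro ⟨hne, hxy, hzy, hxz⟩
    have hv (G' : PDAG V) (hG' : G'.IsDAG) (he : MarkovEquivalent G G') :=
      he.isVStructure hG hG' ⟨hne, hxy, hzy, hxz⟩
    exact ⟨hne, (h.2 x y).2 fun G' hG' he => (hv G' hG' he).2.1,
      (h.2 z y).2 fun G' hG' he => (hv G' hG' he).2.2.1, fun h' => hxz ((h.1 _ _).1 h')⟩

/-- The Verma–Pearl criterion, stated with `C` itself in place of a representative DAG. -/
theorem IsCPDAG.mem_markovClass_iff {C : PDAG V} (hC : C.IsCPDAG) :
    G ∈ C.markovClass ↔ G.IsDAG ∧ G.SameSkeleton C ∧ G.SameVStructures C := by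
  constructor
  · rintro ⟨hG, G₀, hG₀, hC₀, he⟩
    exact ⟨hG, (hC₀.1.trans (he.sameSkeleton hG₀ hG)).symm,
      ((hC₀.sameVStructures hG₀).trans (he.sameVStructures hG₀ hG)).symm⟩
  · rintro ⟨hG, hs, hv⟩
    obtain ⟨G₀, hG₀, hC₀⟩ := hC
    exact ⟨hG, G₀, hG₀, hC₀, .of_same hG₀ hG (hs.trans hC₀.1).symm
      (hv.trans (hC₀.sameVStructures hG₀)).symm⟩

/-- The MPDAG of a nonempty restricted Markov equivalence class. -/
def mpdag (C : PDAG V) (B : Set (PairwiseConstraint V)) (hC : C.IsCPDAG) (hB : C.IsConsistent B) :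
    PDAG V where
  dir x y := ∀ G ∈ C.restrictedClass B, G.dir x y
  undir x y := C.Adj x y ∧ (¬ ∀ G ∈ C.restrictedClass B, G.dir x y) ∧
    ¬ ∀ G ∈ C.restrictedClass B, G.dir y x
  undir_symm _ _ h := ⟨h.1.symm, h.2.2, h.2.1⟩
  undir_irrefl x h := by
    obtain ⟨G, hG⟩ := hB
    have hG' := hC.mem_markovClass_iff.1 hG.1
    exact hG'.1.adj_ne ((hG'.2.1 _ _).2 h.1) rfl
  dir_not_undir _ _ h h' := h'.2.1 h
  acyclic x h := by
    obtain ⟨G, hG⟩ := hB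
    exact G.acyclic x (Relation.TransGen.mono (fun _ _ h => h G hG) _ _ h)

theorem isMPDAGOf_mpdag {C : PDAG V} {B : Set (PairwiseConstraint V)} (hC : C.IsCPDAG)
    (hB : C.IsConsistent B) : (mpdag C B hC hB).IsMPDAGOf C B := by
  obtain ⟨G, hG⟩ := id hB
  have hG' := hC.mem_markovClass_iff.1 hG.1
  have hs : (mpdag C B hC hB).SameSkeleton C := by
    intro x y
    constructor
    · rintro (h | h | h)
      · exact (hG'.2.1 _ _).1 (.inl (h G hG))
      · exact (hG'.2.1 _ _).1 (.inr (.inl (h G hG)))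
      · exact h.1
    · intro h
      by_cases h1 : (mpdag C B hC hB).dir x y
      · exact .inl h1
      by_cases h2 : (mpdag C B hC hB).dir y x
      · exact .inr (.inl h2)
      exact .inr (.inr ⟨h, h1, h2⟩)
  refine ⟨hs, fun x y z => ⟨?_, fun hv => ?_⟩, fun x y => .rfl⟩
  · rintro ⟨hne, hxy, hzy, hxz⟩
    exact (hG'.2.2 x y z).1 ⟨hne, hxy G hG, hzy G hG, fun h =>
      hxz ((hs _ _).2 ((hG'.2.1 _ _).1 h))⟩
  · have hv' (K : PDAG V) (hK : K ∈ C.restrictedClass B) :=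
      ((hC.mem_markovClass_iff.1 hK.1).2.2 x y z).2 hv
    exact ⟨hv.1, fun K hK => (hv' K hK).2.1, fun K hK => (hv' K hK).2.2.1,
      fun h => hv.2.2.2 ((hs _ _).1 h)⟩

theorem undir_iff {x y : V} : G.undir x y ↔ G.Adj x y ∧ ¬ G.dir x y ∧ ¬ G.dir y x := by
  constructor
  · exact fun h => ⟨.inr (.inr h), fun h' => G.dir_not_undir _ _ h' h,
      fun h' => G.dir_not_undir _ _ h' (G.undir_symm _ _ h)⟩
  · rintro ⟨h, h1, h2⟩
    exact (h.resolve_left h1).resolve_left h2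

theorem IsMPDAGOf.unique {C H' : PDAG V} {B : Set (PairwiseConstraint V)} (h : H.IsMPDAGOf C B)
    (h' : H'.IsMPDAGOf C B) : H = H' := by
  have hd (x y : V) : H.dir x y ↔ H'.dir x y := (h.2.2 x y).trans (h'.2.2 x y).symm
  ext x y
  · exact hd x y
  · rw [undir_iff, undir_iff, hd, hd, h.1.trans h'.1.symm x y]

/-! ### Clauses equivalent to pairwise constraints -/

/-- The children of `x` on shortest directed paths from `x` to `y` in the DAGs in `[C]`. -/
def critical (C : PDAG V) (x y : V) : Set V :=
  {c | ∃ G ∈ C.markovClass, G.dir x c ∧ c ∈ G.ancestors {y} ∧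
    G.distTo {y} x = G.distTo {y} c + 1}

theorem mem_ancestors_singleton {x y : V} : x ∈ G.ancestors {y} ↔ G.IsAncestor x y := by
  simp [ancestors]

theorem IsCPDAG.isAncestor_iff {C : PDAG V} (hC : C.IsCPDAG) (hG : G ∈ C.markovClass) {x y : V}
    (hne : x ≠ y) : G.IsAncestor x y ↔ ∃ c ∈ C.critical x y, G.dir x c := by
  constructor
  · intro h
    rcases mem_or_exists_distTo (mem_ancestors_singleton.2 h) with h | ⟨c, hxc, hc, hd⟩
    · exact (hne h).elim
    · exact ⟨c, ⟨G, hG, hxc, hc, hd⟩, hxc⟩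
  · rintro ⟨c, ⟨K, hK, hxc, hc, hd⟩, hxc'⟩
    have hG' := hC.mem_markovClass_iff.1 hG
    have hK' := hC.mem_markovClass_iff.1 hK
    have := mem_ancestors_of_first_edge hK'.1 hG'.1 (hK'.2.1.trans hG'.2.1.symm)
      (hK'.2.2.trans hG'.2.2.symm) hxc hc hd hxc'
    exact .head hxc' (mem_ancestors_singleton.1 this)

/-- A set of clauses that is equivalent in `[C]` to a constraint which holds for some DAG. -/
theorem IsCPDAG.exists_clauses {C : PDAG V} (hC : C.IsCPDAG) (b : PairwiseConstraint V)
    (hb : ∃ G : PDAG V, b.Holds G) :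
    ∃ R : Set (DCC V), ∀ G ∈ C.markovClass, b.Holds G ↔ ∀ κ ∈ R, κ.Holds G := by
  obtain ⟨K, hK⟩ := hb
  cases b with
  | direct x y =>
    refine ⟨{⟨x, {y}, fun h => dir_ne hK h⟩}, fun G _ => ?_⟩
    simp [PairwiseConstraint.Holds, DCC.Holds, children]
  | ancestral x y =>
    by_cases hxy : x = y
    · subst hxy
      exact ⟨∅, fun G _ => by
        simp [PairwiseConstraint.Holds, IsAncestor, Relation.ReflTransGen.refl]⟩
    · refine ⟨{⟨x, C.critical x y, fun ⟨G, _, h, _⟩ => dir_irrefl x h⟩}, fun G hG => ?_⟩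
      rw [PairwiseConstraint.Holds, hC.isAncestor_iff hG hxy]
      simp [DCC.Holds, children, Set.Nonempty]
  | nonAncestral x y =>
    have hxy : x ≠ y := by
      rintro rfl
      exact hK .refl
    -- Critical vertices are adjacent to `x`, so `x → c` fails exactly when `c → x`.
    refine ⟨{κ | κ.tail ∈ C.critical x y ∧ κ.heads = {x}}, fun G hG => ?_⟩
    have hG' := hC.mem_markovClass_iff.1 hG
    rw [PairwiseConstraint.Holds, hC.isAncestor_iff hG hxy]
    constructor
    · rintro h κ ⟨hκ, hκ'⟩
      obtain ⟨K, hK, hx, -⟩ := id hκ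
      have hadj : G.Adj x κ.tail :=
        (hG'.2.1 _ _).2 (((hC.mem_markovClass_iff.1 hK).2.1 _ _).1 (.inl hx))
      refine ⟨x, by simp [hκ'], ?_⟩
      exact hG'.1.dir_of_not_dir hadj.symm fun h' => h ⟨_, hκ, h'⟩
    · rintro h ⟨c, hc, hxc⟩
      obtain ⟨z, hz, hz'⟩ := h ⟨c, {x}, (dir_ne hxc).symm⟩ ⟨hc, rfl⟩
      obtain rfl : z = x := hz
      exact dir_asymm hxc hz'

theorem IsCPDAG.exists_restrictedClass_eq {C : PDAG V} (hC : C.IsCPDAG)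
    {B : Set (PairwiseConstraint V)} (hB : C.IsConsistent B) (hH : H.IsMPDAGOf C B) :
    ∃ R : Set (DCC V), C.restrictedClass B = H.representedWith R := by
  obtain ⟨K, hK⟩ := hB
  choose R hR using fun b : B => hC.exists_clauses b.1 ⟨K, hK.2 b b.2⟩
  refine ⟨⋃ b, R b, Set.ext fun G => ⟨fun hG => ⟨?_, ?_⟩, fun hG => ?_⟩⟩
  · obtain ⟨h1, h2, h3⟩ := hC.mem_markovClass_iff.1 hG.1
    exact ⟨h1, fun x y h => (hH.2.2 x y).1 h G hG, h2.trans hH.1.symm, h3.trans hH.2.1.symm⟩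
  · intro κ hκ
    obtain ⟨b, hκ⟩ := Set.mem_iUnion.1 hκ
    exact (hR b G hG.1).1 (hG.2 b b.2) κ hκ
  · obtain ⟨⟨h1, -, h2, h3⟩, h4⟩ := hG
    have hm : G ∈ C.markovClass :=
      hC.mem_markovClass_iff.2 ⟨h1, h2.trans hH.1, h3.trans hH.2.1⟩
    exact ⟨hm, fun b hb => (hR ⟨b, hb⟩ G hm).2 fun κ hκ =>
      h4 κ (Set.mem_iUnion.2 ⟨⟨b, hb⟩, hκ⟩)⟩

end PDAG

/-! ### Finiteness of the set of clauses and the minimal clause set -/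

instance DCC.finite {V : Type*} [Finite V] : Finite (DCC V) :=
  Finite.of_injective (fun κ : DCC V => (κ.tail, κ.heads)) fun _ _ h =>
    DCC.ext (congrArg Prod.fst h) (congrArg Prod.snd h)

theorem mainTheorem7 {V : Type*} [Finite V] (C : PDAG V) (hC : C.IsCPDAG)
    (B : Set (PairwiseConstraint V)) (hB : C.IsConsistent B) :
    (∃! H : PDAG V, H.IsMPDAGOf C B) ∧
      ∀ H : PDAG V, H.IsMPDAGOf C B →
        ∃ R : Set (DCC V),
          C.restrictedClass B = H.representedWith R ∧
          ∀ R' : Set (DCC V), R' ⊂ R → C.restrictedClass B ⊂ H.representedWith R' := by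
  refine ⟨⟨_, PDAG.isMPDAGOf_mpdag hC hB, fun _ h => h.unique (PDAG.isMPDAGOf_mpdag hC hB)⟩,
    fun H hH => ?_⟩
  -- There are finitely many clauses, so strict inclusion of clause sets is well-founded.
  obtain ⟨R, hR, hmin⟩ := wellFounded_lt.has_min
    {R : Set (DCC V) | C.restrictedClass B = H.representedWith R}
    (hC.exists_restrictedClass_eq hB hH)
  refine ⟨R, hR, fun R' hR' => ?_⟩
  have hle : C.restrictedClass B ⊆ H.representedWith R' := by
    rw [hR]
    exact fun G hG => ⟨hG.1, fun κ hκ => hG.2 κ (hR'.1 hκ)⟩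
  exact hle.ssubset_of_ne fun h => hmin R' h hR'
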